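/- Let $n\ge 2$ be a natural number. For distinct $i,j<n$ let $[i|j]\colon n\to n$ be the replacement that sends $i$ to $j$ and fixes everything else, and let $[i,j]$ be the transposition of $i$ and $j$. Consider (nonempty) algebras of the similarity type $\{\cdot,-,s^i_j,s_{ij}\}_{i\ne j<n}$, where $\cdot$ is binary and all other operations are unary; $a+b$ abbreviates $-(-a\cdot -b)$, $0$ abbreviates $x\cdot -x$ and $1$ abbreviates $x+ -x$. For a set $U$, the full substitution set algebra with transpositions with base $U$ is $\langle\mathcal P({}^nU);\cap,\sim,S^i_j,S_{ij}\rangle_{i\neq j<n}$, where $S^i_j(X)=\{q\in{}^nU: q\circ[i|j]\in X\}$ and $S_{ij}(X)=\{q\in{}^nU: q\circ[i,j]\in X\}$. Let $SetSA_n$ be the class of (isomorphic copies of) subalgebras of such algebras, and let $RSA_n=\mathbf{SP}\,SetSA_n$. Let $\Sigma_n$ consist of the following equations, for all indices $i,j,k,l<n$ such that those occurring in the equation are distinct: (1) the Boolean axioms (a finite equational basis for Boolean algebras in terms of $\cdot$ and $-$); (2) each $s_{ij}$ and each $s^i_j$ preserves $\cdot$, $+$, $0$ and $1$; (3) $s_{ij}x=s_{ji}x$,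 $\;s_{ij}s_{ij}x=x$, $\;s_{ij}s_{jk}s_{ij}x=s_{ik}x$, $\;s_{ij}s_{kl}x=s_{kl}s_{ij}x$; (4) $s_{kl}s^j_is_{kl}x=s^j_ix$, $\;s_{jk}s^j_is_{jk}x=s^k_ix$, $\;s_{ki}s^j_is_{ki}x=s^j_kx$, $\;s_{ij}s^j_is_{ij}x=s^i_jx$; (5) $s^j_is^k_lx=s^k_ls^j_ix$, $\;s^j_is^k_ix=s^k_is^j_ix=s^j_is^k_jx$, $\;s^j_is^i_kx=s^j_ks_{ij}x$, $\;s^j_is^j_kx=s^j_kx$, $\;s^j_is^j_ix=s^j_ix$, $\;s^j_is^i_jx=s^j_ix$, $\;s^j_is_{ij}x=s^j_ix$. Let $SA_n=\mathbf{Mod}(\Sigma_n)$. Then: (a) $\Sigma_n$ is finite, and its equations (2)--(5) are positive, that is, both sides are built from variables, $0$ and $1$ using only $\cdot$, $+$ and the substitution operations. (b) The relations between words given by (3)--(5) form a presentation of the monoid ${}^nn$ of all self-maps of $n$ under composition, with generators $s^i_j\mapsto[i|j]$ and $s_{ij}\mapsto[i,j]$: these maps generate ${}^nn$, and two words in the generators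 have the same value in ${}^nn$ if and only if they are congruent modulo the relations. (c) $RSA_n=SA_n$. (d) Consequently $RSA_n$ is a variety (closed under homomorphic images, subalgebras and direct products) that is axiomatized by a finite set of equations. -/

import Mathlib

open scoped FirstOrder

universe u

namespace SubstAlg

/-! ### Transpositions and replacements in the monoid of self-maps of `n` -/

/-- The names of the substitution operations: `repl i j` is the name `s^i_j` of the replacement
`[i|j]`, and `transp i j` is the name `s_{ij}` of the transposition `[i,j]` (`i ≠ j`). -/
inductive Gen (n : ℕ) : Type
  | repl (i j : Fin n) (h : i ≠ j) : Gen n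
  | transp (i j : Fin n) (h : i ≠ j) : Gen n

/-- The self-map of `n` named by a generator: `[i|j]` sends `i` to `j` and fixes everything else,
`[i,j]` swaps `i` and `j`. -/
def Gen.toFun {n : ℕ} : Gen n → Fin n → Fin n
  | .repl i j _ => Function.update id i j
  | .transp i j _ => Equiv.swap i j

/-- The same self-map, as an element of the monoid of self-maps under composition. -/
def Gen.toEnd {n : ℕ} (g : Gen n) : Function.End (Fin n) := g.toFun

/-- The value `t̂` of a word `t` in the monoid of self-maps of `n` under composition: the empty word
goes to the identity, and `(g t)^ = g ∘ t^` for a generator `g`. -/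
def wordMap (n : ℕ) : FreeMonoid (Gen n) →* Function.End (Fin n) :=
  FreeMonoid.lift Gen.toEnd

/-- The one-letter word `s^i_j`. -/
def r {n : ℕ} (i j : Fin n) (h : i ≠ j) : FreeMonoid (Gen n) := FreeMonoid.of (.repl i j h)

/-- The one-letter word `s_{ij}`. -/
def t {n : ℕ} (i j : Fin n) (h : i ≠ j) : FreeMonoid (Gen n) := FreeMonoid.of (.transp i j h)

/-- The defining relations; all indices occurring in one relation are distinct. -/
inductive Rel (n : ℕ) : FreeMonoid (Gen n) → FreeMonoid (Gen n) → Prop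
  /-- `s_ij = s_ji` -/
  | transp_symm (i j : Fin n) (hij : i ≠ j) : Rel n (t i j hij) (t j i hij.symm)
  /-- `s_ij s_ij = 1` -/
  | transp_sq (i j : Fin n) (hij : i ≠ j) : Rel n (t i j hij * t i j hij) 1
  /-- `s_ij s_jk s_ij = s_ik` -/
  | transp_conj (i j k : Fin n) (hij : i ≠ j) (hik : i ≠ k) (hjk : j ≠ k) :
      Rel n (t i j hij * t j k hjk * t i j hij) (t i k hik)
  /-- `s_ij s_kl = s_kl s_ij` -/
  | transp_comm (i j k l : Fin n) (hij : i ≠ j) (hik : i ≠ k) (hil : i ≠ l) (hjk : j ≠ k)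
      (hjl : j ≠ l) (hkl : k ≠ l) :
      Rel n (t i j hij * t k l hkl) (t k l hkl * t i j hij)
  /-- `s_kl s^j_i s_kl = s^j_i` -/
  | conj_kl (i j k l : Fin n) (hij : i ≠ j) (hik : i ≠ k) (hil : i ≠ l) (hjk : j ≠ k)
      (hjl : j ≠ l) (hkl : k ≠ l) :
      Rel n (t k l hkl * r j i hij.symm * t k l hkl) (r j i hij.symm)
  /-- `s_jk s^j_i s_jk = s^k_i` -/
  | conj_jk (i j k : Fin n) (hij : i ≠ j) (hik : i ≠ k) (hjk : j ≠ k) :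
      Rel n (t j k hjk * r j i hij.symm * t j k hjk) (r k i hik.symm)
  /-- `s_ki s^j_i s_ki = s^j_k` -/
  | conj_ki (i j k : Fin n) (hij : i ≠ j) (hik : i ≠ k) (hjk : j ≠ k) :
      Rel n (t k i hik.symm * r j i hij.symm * t k i hik.symm) (r j k hjk)
  /-- `s_ij s^j_i s_ij = s^i_j` -/
  | conj_ij (i j : Fin n) (hij : i ≠ j) :
      Rel n (t i j hij * r j i hij.symm * t i j hij) (r i j hij)
  /-- `s^j_i s^k_l = s^k_l s^j_i` -/
  | repl_comm (i j k l : Fin n) (hij : i ≠ j) (hik : i ≠ k) (hil : i ≠ l) (hjk : j ≠ k)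
      (hjl : j ≠ l) (hkl : k ≠ l) :
      Rel n (r j i hij.symm * r k l hkl) (r k l hkl * r j i hij.symm)
  /-- `s^j_i s^k_i = s^k_i s^j_i` -/
  | repl_same (i j k : Fin n) (hij : i ≠ j) (hik : i ≠ k) (hjk : j ≠ k) :
      Rel n (r j i hij.symm * r k i hik.symm) (r k i hik.symm * r j i hij.symm)
  /-- `s^k_i s^j_i = s^j_i s^k_j` -/
  | repl_same_chain (i j k : Fin n) (hij : i ≠ j) (hik : i ≠ k) (hjk : j ≠ k) :
      Rel n (r k i hik.symm * r j i hij.symm) (r j i hij.symm * r k j hjk.symm)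
  /-- `s^j_i s^i_k = s^j_k s_ij` -/
  | repl_chain (i j k : Fin n) (hij : i ≠ j) (hik : i ≠ k) (hjk : j ≠ k) :
      Rel n (r j i hij.symm * r i k hik) (r j k hjk * t i j hij)
  /-- `s^j_i s^j_k = s^j_k` -/
  | repl_absorb (i j k : Fin n) (hij : i ≠ j) (hik : i ≠ k) (hjk : j ≠ k) :
      Rel n (r j i hij.symm * r j k hjk) (r j k hjk)
  /-- `s^j_i s^j_i = s^j_i` -/
  | repl_idem (i j : Fin n) (hij : i ≠ j) :
      Rel n (r j i hij.symm * r j i hij.symm) (r j i hij.symm)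
  /-- `s^j_i s^i_j = s^j_i` -/
  | repl_back (i j : Fin n) (hij : i ≠ j) :
      Rel n (r j i hij.symm * r i j hij) (r j i hij.symm)
  /-- `s^j_i s_ij = s^j_i` -/
  | repl_transp (i j : Fin n) (hij : i ≠ j) :
      Rel n (r j i hij.symm * t i j hij) (r j i hij.symm)

/-- `R` is a presentation of the monoid of all self-maps of `n` by the generators `[i|j]`, `[i,j]`:
every self-map is the value of a word, and two words have the same value iff they are congruent
modulo `R`. -/
def IsPresentation (n : ℕ) (R : FreeMonoid (Gen n) → FreeMonoid (Gen n) → Prop) : Prop :=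
  Function.Surjective (wordMap n) ∧
    ∀ w₁ w₂ : FreeMonoid (Gen n), conGen R w₁ w₂ ↔ wordMap n w₁ = wordMap n w₂

/-! ### The similarity type, algebras, terms and equations -/

/-- The operation symbols: meet, complement, and one unary symbol for each generator. -/
inductive Op (n : ℕ) : ℕ → Type
  | meet : Op n 2
  | compl : Op n 1
  | subst (g : Gen n) : Op n 1

/-- The similarity type `{·, -, s^i_j, s_{ij}}`, with `i ≠ j` in `n`. -/
def lang (n : ℕ) : FirstOrder.Language.{0, 0} := ⟨Op n, fun _ => Empty⟩

/-- An algebra of this similarity type (nonempty, as usual). -/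
structure Alg (n : ℕ) : Type (u + 1) where
  carrier : Type u
  [str : (lang n).Structure carrier]
  [nonempty : Nonempty carrier]

attribute [instance] Alg.str Alg.nonempty

/-- Terms in the variables `x₀, x₁, …`. -/
abbrev Tm (n : ℕ) : Type := (lang n).Term ℕ

/-- Equations, as pairs of terms. -/
abbrev Eqn (n : ℕ) : Type := Tm n × Tm n

/-- The variable `x_i`. -/
def x {n : ℕ} (i : ℕ) : Tm n := FirstOrder.Language.Term.var i

/-- The term `a · b`. -/
def tMeet {n : ℕ} (a b : Tm n) : Tm n :=
  FirstOrder.Language.Term.func (L := lang n) (Op.meet : Op n 2) ![a, b]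

/-- The term `-a`. -/
def tCompl {n : ℕ} (a : Tm n) : Tm n :=
  FirstOrder.Language.Term.func (L := lang n) (Op.compl : Op n 1) ![a]

/-- The term `s a`, for a substitution symbol `s`. -/
def tSubst {n : ℕ} (g : Gen n) (a : Tm n) : Tm n :=
  FirstOrder.Language.Term.func (L := lang n) (Op.subst g : Op n 1) ![a]

/-- `a + b` abbreviates `-(-a · -b)`. -/
def tJoin {n : ℕ} (a b : Tm n) : Tm n := tCompl (tMeet (tCompl a) (tCompl b))

/-- `0` abbreviates `x₀ · -x₀`. -/
def tZero {n : ℕ} : Tm n := tMeet (x 0) (tCompl (x 0))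

/-- `1` abbreviates `x₀ + -x₀`. -/
def tOne {n : ℕ} : Tm n := tJoin (x 0) (tCompl (x 0))

/-- The term `s_1 s_2 ⋯ s_m a` for a word `s_1 s_2 ⋯ s_m`. -/
def tWord {n : ℕ} (w : FreeMonoid (Gen n)) (a : Tm n) : Tm n := w.toList.foldr tSubst a

/-- Positive terms: built from variables, `0` and `1` by meets, joins and substitutions. -/
inductive Positive {n : ℕ} : Tm n → Prop
  | var (i : ℕ) : Positive (x i)
  | zero : Positive tZero
  | one : Positive tOne
  | meet {a b : Tm n} : Positive a → Positive b → Positive (tMeet a b)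
  | join {a b : Tm n} : Positive a → Positive b → Positive (tJoin a b)
  | subst (g : Gen n) {a : Tm n} : Positive a → Positive (tSubst g a)

/-- `A ⊨ a = b`. -/
def Alg.Satisfies {n : ℕ} (A : Alg.{u} n) (e : Eqn n) : Prop :=
  ∀ v : ℕ → A.carrier, e.1.realize v = e.2.realize v

/-- `Mod(E)`, the class of all models of a set of equations. -/
def Mod {n : ℕ} (E : Set (Eqn n)) : Set (Alg.{u} n) := {A | ∀ e ∈ E, A.Satisfies e}

/-! ### Class operators and varieties -/

/-- The direct product of a family of algebras. -/
def prodAlg {n : ℕ} {I : Type u} (F : I → Alg.{u} n) : Alg.{u} n where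
  carrier := ∀ i, (F i).carrier
  str :=
    { funMap := fun f a i => FirstOrder.Language.Structure.funMap f (fun k => a k i)
      RelMap := fun r _ => nomatch r }

/-- `H K`: the homomorphic images of members of `K`. -/
def H {n : ℕ} (K : Set (Alg.{u} n)) : Set (Alg.{u} n) :=
  {A | ∃ B ∈ K, ∃ f : B.carrier →[lang n] A.carrier, Function.Surjective f}

/-- `S K`: the algebras isomorphic to a subalgebra of a member of `K`. -/
def S {n : ℕ} (K : Set (Alg.{u} n)) : Set (Alg.{u} n) :=
  {A | ∃ B ∈ K, Nonempty (A.carrier ↪[lang n] B.carrier)}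

/-- `P K`: the algebras isomorphic to a direct product of a family of members of `K`. -/
def P {n : ℕ} (K : Set (Alg.{u} n)) : Set (Alg.{u} n) :=
  {A | ∃ (I : Type u) (F : I → Alg.{u} n), (∀ i, F i ∈ K) ∧
    Nonempty (A.carrier ≃[lang n] (prodAlg F).carrier)}

/-- A variety: a class closed under homomorphic images, subalgebras and direct products. -/
def IsVariety {n : ℕ} (K : Set (Alg.{u} n)) : Prop := H K ⊆ K ∧ S K ⊆ K ∧ P K ⊆ K

/-- `K` is axiomatized by a finite set of equations. -/
def IsFinitelyBased {n : ℕ} (K : Set (Alg.{u} n)) : Prop :=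
  ∃ E : Set (Eqn n), E.Finite ∧ K = Mod E

/-! ### Set algebras -/

/-- The full substitution set algebra with transpositions of dimension `n` with base `U`: the
subsets of `ⁿU` with intersection, complement and `S_τ X = {q | q ∘ τ ∈ X}` for `τ = [i|j]` and
`τ = [i,j]`. -/
def fullAlg (n : ℕ) (U : Type u) : Alg.{u} n where
  carrier := Set (Fin n → U)
  str :=
    { funMap := fun {_} f => match f with
        | Op.meet => fun X => X 0 ∩ X 1
        | Op.compl => fun X => (X 0)ᶜ
        | Op.subst g => fun X => {q | q ∘ g.toFun ∈ X 0}
      RelMap := fun r _ => nomatch r }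
  nonempty := ⟨(∅ : Set (Fin n → U))⟩

/-- `SetSA_n`, the class of subalgebras of full set algebras. -/
def SetSA (n : ℕ) : Set (Alg.{u} n) := S {A | ∃ U : Type u, A = fullAlg n U}

/-- `RSA_n = SP SetSA_n`. -/
def RSA (n : ℕ) : Set (Alg.{u} n) := S (P (SetSA n))

/-! ### The axioms -/

/-- The Boolean axioms. -/
def booleanAxioms (n : ℕ) : Set (Eqn n) :=
  { (tMeet (x 0) (x 1), tMeet (x 1) (x 0)),
    (tJoin (x 0) (x 1), tJoin (x 1) (x 0)),
    (tMeet (tMeet (x 0) (x 1)) (x 2), tMeet (x 0) (tMeet (x 1) (x 2))),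
    (tJoin (tJoin (x 0) (x 1)) (x 2), tJoin (x 0) (tJoin (x 1) (x 2))),
    (tMeet (x 0) (tJoin (x 0) (x 1)), x 0),
    (tJoin (x 0) (tMeet (x 0) (x 1)), x 0),
    (tMeet (x 0) (tJoin (x 1) (x 2)), tJoin (tMeet (x 0) (x 1)) (tMeet (x 0) (x 2))),
    (tJoin (x 0) (tMeet (x 1) (x 2)), tMeet (tJoin (x 0) (x 1)) (tJoin (x 0) (x 2))),
    (tJoin (x 1) tZero, x 1),
    (tMeet (x 1) tOne, x 1) }

/-- The substitutions preserve meets, joins, `0` and `1`. -/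
def endoAxioms (n : ℕ) : Set (Eqn n) :=
  {e | ∃ g : Gen n,
    e = (tSubst g (tMeet (x 0) (x 1)), tMeet (tSubst g (x 0)) (tSubst g (x 1))) ∨
    e = (tSubst g (tJoin (x 0) (x 1)), tJoin (tSubst g (x 0)) (tSubst g (x 1))) ∨
    e = (tSubst g tZero, tZero) ∨
    e = (tSubst g tOne, tOne)}

/-- A relation `w₁ = w₂` between words is encoded by the equation `w₁ x₀ = w₂ x₀`. -/
def relAxioms {n : ℕ} (R : FreeMonoid (Gen n) → FreeMonoid (Gen n) → Prop) : Set (Eqn n) :=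
  {e | ∃ w₁ w₂, R w₁ w₂ ∧ e = (tWord w₁ (x 0), tWord w₂ (x 0))}

/-- The axiom system `Σ_n`. -/
def Ax (n : ℕ) : Set (Eqn n) := booleanAxioms n ∪ endoAxioms n ∪ relAxioms (Rel n)

/-- `SA_n = Mod(Σ_n)`. -/
def SA (n : ℕ) : Set (Alg.{u} n) := Mod (Ax n)

end SubstAlg

namespace SubstAlg

/-! ### The monoid presented by the relations -/

section Presentation

variable {n : ℕ}

/-! The heart of the matter is the presentation of the monoid of self-maps; the representation
theorem then follows by ultrafilters.

Presentation. Every self-map factors as a retraction onto the least elements of its kernel classes,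
followed by a permutation. The relations bring each word to the matching form `p * collapse m`, with
`p` a product of transpositions and `m` as in `IsBlockMin`: a replacement moves past `p` by
conjugation, and is then absorbed by `collapse m`, merges two of its blocks, or turns into a
transposition (`exists_normalForm`). If two normal forms have the same value, their kernels agree,
hence so do their retractions. The permutation parts need agree only on the range of `m`, and
`mul_collapse_of_fixes` shows that `collapse m` absorbs the discrepancy (`conGen_of_wordMap_eq`).

Representation. Set algebras satisfy the equations, and equational classes are closed under `S` and
`P`. Conversely, let `F` be an ultrafilter of a model and map `a` to the set of those `q : n → n`
for which `F` contains `s_q a`. By the presentation, `s_q` depends on `q` only and `s_q s_g = s_{q ∘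
g}`, which is exactly compatibility with substitutions; the Boolean operations are respected because
each `s_q` is a Boolean endomorphism and `F` is an ultrafilter. Distinct elements are separated by
some `F` at `q = id`, so the model embeds in a power of the full set algebra with base `n`. -/

/-- The monoid presented by the relations. -/
abbrev PMon (n : ℕ) : Type := (conGen (Rel n)).Quotient

/-- The class of `s_{ij}` in the presented monoid, with the convention `s_{ii} = 1`. -/
def T (i j : Fin n) : PMon n := if h : i ≠ j then (t i j h : PMon n) else 1

/-- The class of `s^i_j` in the presented monoid, with the convention `s^i_i = 1`. -/
def R (i j : Fin n) : PMon n := if h : i ≠ j then (r i j h : PMon n) else 1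

@[simp] lemma T_self (i : Fin n) : T i i = 1 := by simp [T]

@[simp] lemma R_self (i : Fin n) : R i i = 1 := by simp [R]

lemma T_of_ne {i j : Fin n} (h : i ≠ j) : T i j = (t i j h : PMon n) := by simp [T, h]

lemma R_of_ne {i j : Fin n} (h : i ≠ j) : R i j = (r i j h : PMon n) := by simp [R, h]

lemma coe_eq_of_rel {v w : FreeMonoid (Gen n)} (h : Rel n v w) : (v : PMon n) = w :=
  (Con.eq _).2 (ConGen.Rel.of _ _ h)

lemma T_symm (i j : Fin n) : T i j = T j i := by
  by_cases h : i = j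
  · rw [h]
  · rw [T_of_ne h, T_of_ne (Ne.symm h)]
    exact coe_eq_of_rel (.transp_symm i j h)

@[simp] lemma T_mul_self (i j : Fin n) : T i j * T i j = 1 := by
  by_cases h : i = j
  · simp [h]
  · rw [T_of_ne h]
    exact coe_eq_of_rel (.transp_sq i j h)

@[simp] lemma T_mul_T_mul (i j : Fin n) (w : PMon n) : T i j * (T i j * w) = w := by
  rw [← mul_assoc, T_mul_self, one_mul]

lemma T_conj_chain {i j k : Fin n} (hij : i ≠ j) (hik : i ≠ k) (hjk : j ≠ k) :
    T i j * T j k * T i j = T i k := by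
  rw [T_of_ne hij, T_of_ne hik, T_of_ne hjk]
  exact coe_eq_of_rel (.transp_conj i j k hij hik hjk)

/-- Transpositions act on transpositions by conjugation. -/
lemma T_conj_T (a b c d : Fin n) :
    T a b * T c d * T a b = T (Equiv.swap a b c) (Equiv.swap a b d) := by
  by_cases hab : a = b
  · simp [hab]
  by_cases hcd : c = d
  · simp [hcd]
  by_cases hca : c = a
  · subst hca
    by_cases hdb : d = b
    · subst hdb; simp [T_symm]
    · rw [Equiv.swap_apply_left, Equiv.swap_apply_of_ne_of_ne (Ne.symm hcd) hdb, T_symm c b]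
      exact T_conj_chain (Ne.symm hab) (Ne.symm hdb) hcd
  by_cases hcb : c = b
  · subst hcb
    by_cases hda : d = a
    · subst hda; simp [T_symm]
    · rw [Equiv.swap_apply_right, Equiv.swap_apply_of_ne_of_ne hda (Ne.symm hcd)]
      exact T_conj_chain hab (Ne.symm hda) hcd
  rw [Equiv.swap_apply_of_ne_of_ne hca hcb]
  by_cases hda : d = a
  · subst hda
    rw [Equiv.swap_apply_left, T_symm d b, T_symm c d, T_symm c b]
    exact T_conj_chain (Ne.symm hab) (Ne.symm hcb) (Ne.symm hcd)
  by_cases hdb : d = b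
  · subst hdb
    rw [Equiv.swap_apply_right, T_symm c d, T_symm c a]
    exact T_conj_chain hab (Ne.symm hca) (Ne.symm hcd)
  rw [Equiv.swap_apply_of_ne_of_ne hda hdb]
  have h : T a b * T c d = T c d * T a b := by
    rw [T_of_ne hab, T_of_ne hcd]
    exact coe_eq_of_rel
      (.transp_comm a b c d hab (Ne.symm hca) (Ne.symm hda) (Ne.symm hcb) (Ne.symm hdb) hcd)
  rw [h, mul_assoc, T_mul_self, mul_one]

/-- Transpositions act on replacements by conjugation. -/
lemma T_conj_R (a b c d : Fin n) :
    T a b * R c d * T a b = R (Equiv.swap a b c) (Equiv.swap a b d) := by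
  by_cases hab : a = b
  · simp [hab]
  by_cases hcd : c = d
  · simp [hcd]
  have conj_source : ∀ {i j k : Fin n}, i ≠ j → i ≠ k → j ≠ k →
      T j k * R j i * T j k = R k i := by
    intro i j k hij hik hjk
    rw [T_of_ne hjk, R_of_ne hij.symm, R_of_ne hik.symm]
    exact coe_eq_of_rel (.conj_jk i j k hij hik hjk)
  have conj_target : ∀ {i j k : Fin n}, i ≠ j → i ≠ k → j ≠ k →
      T k i * R j i * T k i = R j k := by
    intro i j k hij hik hjk
    rw [T_of_ne hik.symm, R_of_ne hij.symm, R_of_ne hjk]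
    exact coe_eq_of_rel (.conj_ki i j k hij hik hjk)
  have conj_both : ∀ {i j : Fin n}, i ≠ j → T i j * R j i * T i j = R i j := by
    intro i j hij
    rw [T_of_ne hij, R_of_ne hij.symm, R_of_ne hij]
    exact coe_eq_of_rel (.conj_ij i j hij)
  by_cases hca : c = a
  · subst hca
    by_cases hdb : d = b
    · subst hdb
      rw [Equiv.swap_apply_left, Equiv.swap_apply_right, T_symm]
      exact conj_both (Ne.symm hab)
    · rw [Equiv.swap_apply_left, Equiv.swap_apply_of_ne_of_ne (Ne.symm hcd) hdb]
      exact conj_source (Ne.symm hcd) hdb hab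
  by_cases hcb : c = b
  · subst hcb
    by_cases hda : d = a
    · subst hda
      rw [Equiv.swap_apply_left, Equiv.swap_apply_right]
      exact conj_both hab
    · rw [Equiv.swap_apply_right, Equiv.swap_apply_of_ne_of_ne hda (Ne.symm hcd), T_symm]
      exact conj_source (Ne.symm hcd) hda (Ne.symm hab)
  rw [Equiv.swap_apply_of_ne_of_ne hca hcb]
  by_cases hda : d = a
  · subst hda
    rw [Equiv.swap_apply_left, T_symm]
    exact conj_target (Ne.symm hca) hab hcb
  by_cases hdb : d = b
  · subst hdb
    rw [Equiv.swap_apply_right]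
    exact conj_target (Ne.symm hcb) (Ne.symm hab) hca
  rw [Equiv.swap_apply_of_ne_of_ne hda hdb, T_of_ne hab, R_of_ne hcd]
  exact coe_eq_of_rel (.conj_kl d c a b (Ne.symm hcd) hda hdb hca hcb hab)

lemma T_mul_T_eq (a b c d : Fin n) :
    T a b * T c d = T (Equiv.swap a b c) (Equiv.swap a b d) * T a b := by
  rw [← T_conj_T, mul_assoc _ (T a b), T_mul_self, mul_one]

lemma R_mul_T_eq (a b c d : Fin n) :
    R c d * T a b = T a b * R (Equiv.swap a b c) (Equiv.swap a b d) := by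
  rw [← T_conj_R, mul_assoc (T a b), T_mul_T_mul]

/-- A second replacement of the same index has no effect. -/
lemma R_mul_R_same_source (i : Fin n) {j k : Fin n} (hjk : j ≠ k) : R j i * R j k = R j k := by
  by_cases hij : i = j
  · subst hij; simp
  by_cases hik : i = k
  · subst hik
    rw [R_of_ne hjk]
    exact coe_eq_of_rel (.repl_idem i j hij)
  · rw [R_of_ne (Ne.symm hij), R_of_ne hjk]
    exact coe_eq_of_rel (.repl_absorb i j k hij hik hjk)

lemma R_mul_T_self (i j : Fin n) : R j i * T i j = R j i := by
  by_cases hij : i = j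
  · simp [hij]
  · rw [R_of_ne (Ne.symm hij), T_of_ne hij]
    exact coe_eq_of_rel (.repl_transp i j hij)

/-- The two replacements between `i` and `j` differ by a transposition on the left. -/
lemma R_eq_T_mul_R (i j : Fin n) : R j i = T i j * R i j := by
  conv_lhs => rw [← R_mul_T_self, R_mul_T_eq, Equiv.swap_apply_left, Equiv.swap_apply_right]

/-- After replacing `i` by something else, moving `j` to `i` amounts to a transposition. -/
lemma R_mul_R_chain {i k : Fin n} (hik : i ≠ k) (j : Fin n) : R j i * R i k = T i j * R i k := by
  by_cases hij : i = j
  · simp [hij]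
  by_cases hjk : j = k
  · subst hjk
    rw [← R_eq_T_mul_R, R_of_ne hik, R_of_ne (Ne.symm hij)]
    exact coe_eq_of_rel (.repl_back i j hij)
  · have h : R j i * R i k = R j k * T i j := by
      rw [R_of_ne (Ne.symm hij), R_of_ne hik, R_of_ne hjk, T_of_ne hij]
      exact coe_eq_of_rel (.repl_chain i j k hij hik hjk)
    rw [h, R_mul_T_eq, Equiv.swap_apply_right,
      Equiv.swap_apply_of_ne_of_ne (Ne.symm hik) (Ne.symm hjk)]

/-- Replacements commute if no target is a source. -/
lemma R_comm {i j k l : Fin n} (hij : i ≠ j) (hik : i ≠ k) (hjk : j ≠ k) (hjl : j ≠ l)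
    (hkl : k ≠ l) : R j i * R k l = R k l * R j i := by
  by_cases hil : i = l
  · subst hil
    rw [R_of_ne (Ne.symm hij), R_of_ne hkl]
    exact coe_eq_of_rel (.repl_same i j k hij hik hjk)
  · rw [R_of_ne (Ne.symm hij), R_of_ne hkl]
    exact coe_eq_of_rel (.repl_comm i j k l hij hik hil hjk hjl hkl)

/-- When the block represented by `j` is merged into that of `i`, this redirects a member `k` of the
block from `j` to `i`. -/
lemma R_mul_R_trans {i j k : Fin n} (hij : i ≠ j) (hik : i ≠ k) (hjk : j ≠ k) :
    R j i * R k j = R k i * R j i := by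
  rw [R_of_ne hij.symm, R_of_ne hik.symm, R_of_ne hjk.symm]
  exact (coe_eq_of_rel (.repl_same_chain i j k hij hik hjk)).symm

end Presentation

/-! ### Products of replacements along an idempotent map -/

section Collapse

variable {n : ℕ} {m : Fin n → Fin n}

/-- Targets are fixed points of `m`, and nontrivial sources are not, so no target is a source. Hence
the order of the factors in `collapse m` is immaterial. -/
lemma commute_R_idem (hm : ∀ x, m (m x) = m x) (j k : Fin n) :
    R j (m j) * R k (m k) = R k (m k) * R j (m j) := by
  by_cases hj : m j = j
  · simp [hj]
  by_cases hk : m k = k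
  · simp [hk]
  by_cases hjk : j = k
  · rw [hjk]
  refine R_comm hj ?_ hjk ?_ (Ne.symm hk)
  · rintro rfl; exact hk (hm j)
  · rintro rfl; exact hj (hm k)

/-- The product of the replacements `s^x_{m x}` over the indices `x` in a list. -/
def collapseList (m : Fin n → Fin n) (l : List (Fin n)) : PMon n :=
  (l.map fun x => R x (m x)).prod

/-- The product of all replacements `s^x_{m x}`. -/
def collapse (m : Fin n → Fin n) : PMon n := collapseList m (List.finRange n)

lemma commute_R_collapseList (hm : ∀ x, m (m x) = m x) (j : Fin n) (l : List (Fin n)) :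
    R j (m j) * collapseList m l = collapseList m l * R j (m j) := by
  induction l with
  | nil => simp [collapseList]
  | cons k l ih =>
    simp only [collapseList, List.map_cons, List.prod_cons] at ih ⊢
    rw [← mul_assoc, commute_R_idem hm, mul_assoc, ih, mul_assoc]

lemma R_mul_collapse (hm : ∀ x, m (m x) = m x) (j : Fin n) :
    R j (m j) * collapse m = collapse m := by
  have key : ∀ l : List (Fin n), j ∈ l → R j (m j) * collapseList m l = collapseList m l := by
    intro l
    induction l with
    | nil => simp
    | cons k l ih =>
      intro h
      simp only [collapseList, List.map_cons, List.prod_cons] at ih ⊢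
      rw [← mul_assoc]
      rcases List.mem_cons.1 h with rfl | h
      · by_cases hj : m j = j
        · simp [hj]
        · rw [R_mul_R_same_source _ (Ne.symm hj)]
      · rw [commute_R_idem hm, mul_assoc, ih h]
  exact key _ (List.mem_finRange j)

/-- A replacement between two fixed points of `m` merges two blocks. -/
lemma R_mul_collapse_merge (hm : ∀ x, m (m x) = m x) {i j : Fin n} (hij : i ≠ j) (hi : m i = i)
    (hj : m j = j) {m' : Fin n → Fin n} (hm' : ∀ x, m' x = if m x = j then i else m x) :
    R j i * collapse m = collapse m' := by
  have idem' : ∀ x, m' (m' x) = m' x := by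
    intro x
    rw [hm' x]
    split_ifs with h
    · rw [hm', hi, if_neg hij]
    · rw [hm', hm, if_neg h]
  -- Passing `R j i` to the right through one factor changes its target from `m k` to `m' k`. The
  -- new factor at `k = j` arises from idempotence of `R j i`.
  have step : ∀ k, R j i * R k (m k) = R k (m' k) * R j i := by
    intro k
    rw [hm' k]
    by_cases hkj : k = j
    · subst hkj
      rw [hj, if_pos rfl, R_self, mul_one, R_mul_R_same_source _ (Ne.symm hij)]
    by_cases hk : m k = k
    · simp [hk, hkj]
    have hki : i ≠ k := by rintro rfl; exact hk hi
    split_ifs with h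
    · rw [h, R_mul_R_trans hij hki (Ne.symm hkj)]
    · exact R_comm hij hki (Ne.symm hkj) (Ne.symm h) (Ne.symm hk)
  have move : ∀ l, R j i * collapseList m l = collapseList m' l * R j i := by
    intro l
    induction l with
    | nil => simp [collapseList]
    | cons k l ih =>
      simp only [collapseList, List.map_cons, List.prod_cons] at ih ⊢
      rw [← mul_assoc, step, mul_assoc, ih, mul_assoc]
  -- The `R j i` left over at the right end is `R j (m' j)`, a factor of `collapse m'`, so it
  -- commutes to the left and is absorbed.
  have hji : m' j = i := by rw [hm', hj, if_pos rfl]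
  have absorb := R_mul_collapse idem' j
  rw [hji] at absorb
  have comm := commute_R_collapseList idem' j (List.finRange n)
  rw [hji] at comm
  exact (move _).trans (comm.symm.trans absorb)

/-- Transpositions of indices that are not in the range of `m` are absorbed. -/
lemma T_mul_collapse (hm : ∀ x, m (m x) = m x) {j k : Fin n} (hj : m j ≠ j) (hk : m k ≠ k) :
    T j k * collapse m = collapse m := by
  -- A factor `R k (m k)` of `collapse m` turns the transposition into the replacement `R j k`, and
  -- a factor `R j (m j)` then cancels that.
  calc T j k * collapse m = T k j * (R k (m k) * collapse m) := by
        rw [T_symm, R_mul_collapse hm]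
    _ = R j k * (R j (m j) * collapse m) := by
        rw [← mul_assoc, ← R_mul_R_chain (Ne.symm hk), mul_assoc, R_mul_collapse hm,
          R_mul_collapse hm]
    _ = collapse m := by
        rw [← mul_assoc, R_mul_R_same_source _ (Ne.symm hj), R_mul_collapse hm]

end Collapse

/-! ### Values in the monoid of self-maps -/

section Value

variable {n : ℕ}

lemma wordMap_t {i j : Fin n} (h : i ≠ j) (x : Fin n) :
    wordMap n (t i j h) x = Equiv.swap i j x := by
  simp [wordMap, t, Gen.toEnd, Gen.toFun]

lemma wordMap_r {i j : Fin n} (h : i ≠ j) (x : Fin n) :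
    wordMap n (r i j h) x = if x = i then j else x := by
  simp [wordMap, r, Gen.toEnd, Gen.toFun, Function.update_apply]

lemma wordMap_mul (v w : FreeMonoid (Gen n)) (x : Fin n) :
    wordMap n (v * w) x = wordMap n v (wordMap n w x) := by
  rw [map_mul]; rfl

lemma wordMap_eq_of_rel {v w : FreeMonoid (Gen n)} (h : Rel n v w) :
    wordMap n v = wordMap n w := by
  funext x
  cases h <;>
    simp only [wordMap_mul, wordMap_t, wordMap_r, map_one, Equiv.swap_apply_def,
      Function.End.one_def, id] <;> grind

/-- The value of an element of the presented monoid. -/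
def value (n : ℕ) : PMon n →* Function.End (Fin n) :=
  Con.lift _ (wordMap n) (Con.conGen_le.2 fun _ _ h => wordMap_eq_of_rel h)

lemma value_coe (w : FreeMonoid (Gen n)) : value n (w : PMon n) = wordMap n w := rfl

lemma value_mul (v w : PMon n) (x : Fin n) : value n (v * w) x = value n v (value n w x) := by
  rw [map_mul]; rfl

lemma value_one (x : Fin n) : value n 1 x = x := by rw [map_one]; rfl

lemma value_T (i j x : Fin n) : value n (T i j) x = Equiv.swap i j x := by
  by_cases h : i = j
  · subst h; simp [value_one]
  · rw [T_of_ne h]; exact wordMap_t h x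

lemma value_R (i j x : Fin n) : value n (R i j) x = if x = i then j else x := by
  by_cases h : i = j
  · subst h; simp +contextual [value_one]
  · rw [R_of_ne h]; exact wordMap_r h x

/-- A factor `R k (m k)` applied later could move `m x` only if `m x = k`, but then `k` is fixed by
`m`. -/
lemma value_collapse {m : Fin n → Fin n} (hm : ∀ x, m (m x) = m x) (x : Fin n) :
    value n (collapse m) x = m x := by
  have key : ∀ l : List (Fin n),
      value n (collapseList m l) x = if x ∈ l then m x else x := by
    intro l
    induction l with
    | nil => simp [collapseList, value_one]
    | cons k l ih =>
      simp only [collapseList, List.map_cons, List.prod_cons] at ih ⊢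
      rw [value_mul, value_R, ih]
      grind
  rw [collapse, key, if_pos (List.mem_finRange x)]

end Value

/-! ### Products of transpositions -/

section Transpositions

variable {n : ℕ}

/-- The submonoid generated by the transpositions of elements of `s`. -/
def transpositions (s : Finset (Fin n)) : Submonoid (PMon n) :=
  Submonoid.closure {w | ∃ i ∈ s, ∃ j ∈ s, w = T i j}

lemma T_mem_transpositions {s : Finset (Fin n)} {i j : Fin n} (hi : i ∈ s) (hj : j ∈ s) :
    T i j ∈ transpositions s :=
  Submonoid.subset_closure ⟨i, hi, j, hj, rfl⟩

lemma exists_inv_of_mem_transpositions {s : Finset (Fin n)} {p : PMon n}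
    (hp : p ∈ transpositions s) : ∃ q ∈ transpositions s, q * p = 1 ∧ p * q = 1 := by
  induction hp using Submonoid.closure_induction with
  | mem w hw =>
    obtain ⟨i, hi, j, hj, rfl⟩ := hw
    exact ⟨_, T_mem_transpositions hi hj, T_mul_self i j, T_mul_self i j⟩
  | one => exact ⟨1, one_mem _, one_mul 1, one_mul 1⟩
  | mul a b _ _ iha ihb =>
    obtain ⟨a', ha', h₁, h₂⟩ := iha
    obtain ⟨b', hb', h₃, h₄⟩ := ihb
    refine ⟨b' * a', mul_mem hb' ha', ?_, ?_⟩
    · rw [mul_assoc, ← mul_assoc a', h₁, one_mul, h₃]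
    · rw [mul_assoc, ← mul_assoc b, h₄, one_mul, h₂]

lemma value_injective_of_mem_transpositions {s : Finset (Fin n)} {p : PMon n}
    (hp : p ∈ transpositions s) : Function.Injective (value n p) := by
  obtain ⟨q, -, hq, -⟩ := exists_inv_of_mem_transpositions hp
  refine Function.LeftInverse.injective (g := value n q) fun x => ?_
  rw [← value_mul, hq, value_one]

lemma value_of_mem_transpositions {s : Finset (Fin n)} {p : PMon n}
    (hp : p ∈ transpositions s) {a : Fin n} (ha : a ∉ s) : value n p a = a := by
  induction hp using Submonoid.closure_induction with
  | mem w hw =>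
    obtain ⟨i, hi, j, hj, rfl⟩ := hw
    rw [value_T]
    exact Equiv.swap_apply_of_ne_of_ne (by rintro rfl; exact ha hi) (by rintro rfl; exact ha hj)
  | one => exact value_one a
  | mul p q _ _ ihp ihq => rw [value_mul, ihq, ihp]

/-- Every product of transpositions of `insert a s` is a transposition involving `a` followed by
a product of transpositions of `s`. -/
lemma exists_T_mul_of_mem_transpositions_insert {s : Finset (Fin n)} {a : Fin n} {p : PMon n}
    (hp : p ∈ transpositions (insert a s)) :
    ∃ b ∈ insert a s, ∃ q ∈ transpositions s, p = T a b * q := by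
  induction hp using Submonoid.closure_induction_left with
  | one => exact ⟨a, Finset.mem_insert_self a s, 1, one_mem _, by simp⟩
  | mul_left w hw p _ ih =>
    obtain ⟨b, hb, q, hq, rfl⟩ := ih
    -- The case of a new factor `T a d` involving `a`: generically `T a d * T a b = T a b * T b d`,
    -- and in the degenerate cases one of the transpositions disappears.
    have key : ∀ d ∈ insert a s, ∃ b' ∈ insert a s, ∃ q' ∈ transpositions s,
        T a d * (T a b * q) = T a b' * q' := by
      intro d hd
      by_cases hda : d = a
      · exact ⟨b, hb, q, hq, by simp [hda]⟩
      by_cases hba : b = a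
      · exact ⟨d, hd, q, hq, by simp [hba]⟩
      by_cases hbd : b = d
      · exact ⟨a, Finset.mem_insert_self a s, q, hq, by simp [hbd]⟩
      refine ⟨b, hb, T b d * q, mul_mem (T_mem_transpositions
        (Finset.mem_of_mem_insert_of_ne hb hba) (Finset.mem_of_mem_insert_of_ne hd hda)) hq, ?_⟩
      rw [← mul_assoc, ← mul_assoc, T_mul_T_eq a b b d, Equiv.swap_apply_right,
        Equiv.swap_apply_of_ne_of_ne hda (Ne.symm hbd)]
    obtain ⟨c, hc, d, hd, rfl⟩ := hw
    by_cases hca : c = a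
    · rw [hca]; exact key d hd
    by_cases hda : d = a
    · rw [hda, T_symm]; exact key c hc
    have hc' := Finset.mem_of_mem_insert_of_ne hc hca
    have hd' := Finset.mem_of_mem_insert_of_ne hd hda
    refine ⟨Equiv.swap c d b, ?_, T c d * q, mul_mem (T_mem_transpositions hc' hd') hq, ?_⟩
    · rw [Equiv.swap_apply_def]; split_ifs <;> assumption
    · rw [← mul_assoc, T_mul_T_eq, Equiv.swap_apply_of_ne_of_ne (Ne.symm hca) (Ne.symm hda),
        mul_assoc]

/-- A product of transpositions that fixes the range of `m` is absorbed by `collapse m`. -/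
lemma mul_collapse_of_fixes {m : Fin n → Fin n} (hm : ∀ x, m (m x) = m x)
    (s : Finset (Fin n)) : ∀ p ∈ transpositions s, (∀ x, m x = x → value n p x = x) →
      p * collapse m = collapse m := by
  induction s using Finset.induction_on with
  | empty =>
    intro p hp _
    have : p = 1 := by simpa [transpositions] using hp
    rw [this, one_mul]
  | insert a s ha ih =>
    intro p hp hfix
    obtain ⟨b, hb, q, hq, rfl⟩ := exists_T_mul_of_mem_transpositions_insert hp
    -- Since `q` does not move `a`, the index `b` is the value of the whole product at `a`.
    have hab : value n (T a b * q) a = b := by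
      rw [value_mul, value_of_mem_transpositions hq ha, value_T, Equiv.swap_apply_left]
    by_cases hba : b = a
    · subst hba
      rw [T_self, one_mul] at hfix ⊢
      exact ih q hq hfix
    have hma : m a ≠ a := fun h => hba (hab.symm.trans (hfix a h))
    -- If `m` fixed `b`, the product would send both `a` and `b` to `b`.
    have hmb : m b ≠ b := fun h =>
      hba (value_injective_of_mem_transpositions hp ((hfix b h).trans hab.symm))
    rw [mul_assoc, ih q hq, T_mul_collapse hm hma hmb]
    intro x hx
    have := hfix x hx
    rw [value_mul, value_T] at this
    refine (Equiv.swap_apply_eq_iff.1 this).trans ?_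
    exact Equiv.swap_apply_of_ne_of_ne (by rintro rfl; exact hma hx) (by rintro rfl; exact hmb hx)

/-- Replacements can be moved past products of transpositions. -/
lemma exists_R_mul_eq {s : Finset (Fin n)} {p : PMon n} (hp : p ∈ transpositions s) :
    ∀ i j, ∃ i' j', R i j * p = p * R i' j' := by
  induction hp using Submonoid.closure_induction with
  | mem w hw =>
    obtain ⟨a, -, b, -, rfl⟩ := hw
    exact fun i j => ⟨_, _, R_mul_T_eq a b i j⟩
  | one => exact fun i j => ⟨i, j, by simp⟩
  | mul p q _ _ ihp ihq =>
    intro i j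
    obtain ⟨i', j', h⟩ := ihp i j
    obtain ⟨i'', j'', h'⟩ := ihq i' j'
    exact ⟨i'', j'', by rw [← mul_assoc, h, mul_assoc, h', mul_assoc]⟩

end Transpositions

/-! ### The normal form -/

section NormalForm

variable {n : ℕ}

/-- `m` sends every index to the least index of its block. -/
def IsBlockMin (m : Fin n → Fin n) : Prop := (∀ x, m (m x) = m x) ∧ ∀ x, m x ≤ x

/-- Both `m x` and `m' x` are the least element of the common block of `x`. -/
lemma IsBlockMin.eq_of_ker {m m' : Fin n → Fin n} (h : IsBlockMin m) (h' : IsBlockMin m')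
    (hker : ∀ x y, m x = m y ↔ m' x = m' y) : m = m' := by
  funext x
  apply le_antisymm
  · rw [← (hker (m' x) x).2 (h'.1 x)]
    exact h.2 _
  · rw [← (hker (m x) x).1 (h.1 x)]
    exact h'.2 _

/-- If `m` moves `j`, the replacement is absorbed. If `m` fixes `j` but moves `i`, it acts as `T i
j`. If both are fixed, two blocks merge. -/
lemma exists_R_mul_collapse {m : Fin n → Fin n} (hm : IsBlockMin m) (j i : Fin n) :
    ∃ p ∈ transpositions (Finset.univ : Finset (Fin n)), ∃ m', IsBlockMin m' ∧
      R j i * collapse m = p * collapse m' := by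
  have hT : ∀ a b : Fin n, T a b ∈ transpositions (Finset.univ : Finset (Fin n)) := fun a b =>
    T_mem_transpositions (Finset.mem_univ a) (Finset.mem_univ b)
  by_cases hij : i = j
  · exact ⟨1, one_mem _, m, hm, by simp [hij]⟩
  by_cases hj : m j = j
  · by_cases hi : m i = i
    -- Merging towards the smaller representative keeps `m' x ≤ x`. For the opposite direction,
    -- `R_eq_T_mul_R` reverses the replacement at the cost of a transposition on the left.
    · have merge : ∀ i j, m i = i → m j = j → i < j → ∃ m', IsBlockMin m' ∧
          R j i * collapse m = collapse m' := by
        intro i j hi hj hij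
        refine ⟨fun x => if m x = j then i else m x, ⟨fun x => ?_, fun x => ?_⟩,
          R_mul_collapse_merge hm.1 hij.ne hi hj fun _ => rfl⟩
        · by_cases h : m x = j
          · simp [h, hi, hij.ne]
          · simp [h, hm.1]
        · by_cases h : m x = j
          · simpa [h] using hij.le.trans (h ▸ hm.2 x)
          · simpa [h] using hm.2 x
      rcases lt_or_gt_of_ne hij with h | h
      · obtain ⟨m', hm', e⟩ := merge i j hi hj h
        exact ⟨1, one_mem _, m', hm', by rw [e, one_mul]⟩
      · obtain ⟨m', hm', e⟩ := merge j i hj hi h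
        exact ⟨T i j, hT i j, m', hm', by rw [R_eq_T_mul_R, mul_assoc, e]⟩
    · refine ⟨T i j, hT i j, m, hm, ?_⟩
      conv_lhs => rw [← R_mul_collapse hm.1 i, ← mul_assoc, R_mul_R_chain (Ne.symm hi), mul_assoc,
        R_mul_collapse hm.1]
  · refine ⟨1, one_mem _, m, hm, ?_⟩
    conv_lhs => rw [← R_mul_collapse hm.1 j, ← mul_assoc, R_mul_R_same_source _ (Ne.symm hj),
      R_mul_collapse hm.1]
    rw [one_mul]

lemma exists_normalForm (w : FreeMonoid (Gen n)) :
    ∃ p ∈ transpositions (Finset.univ : Finset (Fin n)), ∃ m, IsBlockMin m ∧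
      (w : PMon n) = p * collapse m := by
  induction w using FreeMonoid.inductionOn' with
  | one =>
    refine ⟨1, one_mem _, id, ⟨fun _ => rfl, fun _ => le_rfl⟩, ?_⟩
    simp [collapse, collapseList]
  | of_mul g w ih =>
    obtain ⟨p, hp, m, hm, e⟩ := ih
    rw [Con.coe_mul, e]
    cases g with
    | transp i j h =>
      refine ⟨T i j * p, mul_mem (T_mem_transpositions (Finset.mem_univ i) (Finset.mem_univ j)) hp,
        m, hm, ?_⟩
      rw [T_of_ne h, mul_assoc]; rfl
    | repl i j h =>
      obtain ⟨i', j', h₁⟩ := exists_R_mul_eq hp i j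
      obtain ⟨q, hq, m', hm', h₂⟩ := exists_R_mul_collapse hm i' j'
      refine ⟨p * q, mul_mem hp hq, m', hm', ?_⟩
      rw [mul_assoc, ← h₂, ← mul_assoc p, ← h₁, R_of_ne h, mul_assoc]; rfl

lemma conGen_of_wordMap_eq {v w : FreeMonoid (Gen n)} (h : wordMap n v = wordMap n w) :
    conGen (Rel n) v w := by
  obtain ⟨p, hp, m, hm, e⟩ := exists_normalForm v
  obtain ⟨q, hq, m', hm', e'⟩ := exists_normalForm w
  have hv : ∀ x, wordMap n v x = value n p (m x) := fun x => by
    rw [← value_coe, e, value_mul, value_collapse hm.1]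
  have hw : ∀ x, wordMap n w x = value n q (m' x) := fun x => by
    rw [← value_coe, e', value_mul, value_collapse hm'.1]
  have hmm : m = m' := hm.eq_of_ker hm' fun x y => by
    rw [← (value_injective_of_mem_transpositions hp).eq_iff, ← hv, ← hv, h, hw, hw,
      (value_injective_of_mem_transpositions hq).eq_iff]
  subst hmm
  -- Cancelling `q` leaves `q' * p`, which fixes the range of `m` because the two values agree
  -- there.
  obtain ⟨q', hq', h₁, h₂⟩ := exists_inv_of_mem_transpositions hq
  have key := mul_collapse_of_fixes hm.1 _ (q' * p) (mul_mem hq' hp) fun x hx => by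
    rw [value_mul]
    have := hv x
    rw [hx] at this
    rw [← this, h, hw, hx, ← value_mul, h₁, value_one]
  refine (Con.eq _).1 ?_
  conv_rhs => rw [e', ← key, ← mul_assoc, ← mul_assoc, h₂, one_mul, ← e]

lemma exists_wordMap_of_perm (σ : Equiv.Perm (Fin n)) : ∃ w, ∀ x, wordMap n w x = σ x := by
  induction σ using Equiv.Perm.swap_induction_on with
  | one => exact ⟨1, fun _ => rfl⟩
  | swap_mul σ i j hij ih =>
    obtain ⟨w, hw⟩ := ih
    exact ⟨t i j hij * w, fun x => by rw [wordMap_mul, hw, wordMap_t]; rfl⟩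

/-- Induction on the number of missed points. If `f a = f b` with `a ≠ b`, sending `a` to a missed
point `c` instead enlarges the range, and precomposing with `[a|b]` recovers `f`. -/
lemma exists_wordMap (f : Fin n → Fin n) : ∃ w, ∀ x, wordMap n w x = f x := by
  induction hk : (Finset.univ.image f)ᶜ.card using Nat.strong_induction_on generalizing f with
  | _ k ih =>
  by_cases hf : Function.Injective f
  · exact exists_wordMap_of_perm (Equiv.ofBijective f (Finite.injective_iff_bijective.1 hf))
  obtain ⟨a, b, hfab, hab⟩ : ∃ a b, f a = f b ∧ a ≠ b := by
    simpa [Function.Injective] using hf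
  obtain ⟨c, hc⟩ : ∃ c, ∀ x, f x ≠ c := by
    have : ¬ Function.Surjective f := fun h => hf (Finite.injective_iff_surjective.2 h)
    simpa [Function.Surjective] using this
  have hlt : (Finset.univ.image (Function.update f a c))ᶜ.card < k := by
    rw [← hk]
    apply Finset.card_lt_card
    rw [Finset.compl_ssubset_compl, Finset.ssubset_iff_of_subset]
    · exact ⟨c, Finset.mem_image.2 ⟨a, Finset.mem_univ a, Function.update_self ..⟩, by simp [hc]⟩
    · intro y hy
      obtain ⟨x, -, rfl⟩ := Finset.mem_image.1 hy
      by_cases hx : x = a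
      · exact Finset.mem_image.2
          ⟨b, Finset.mem_univ b, by rw [Function.update_of_ne hab.symm, hx, hfab]⟩
      · exact Finset.mem_image.2 ⟨x, Finset.mem_univ x, Function.update_of_ne hx ..⟩
  obtain ⟨w, hw⟩ := ih _ hlt _ rfl
  refine ⟨w * r a b hab, fun x => ?_⟩
  rw [wordMap_mul, hw, wordMap_r]
  split_ifs with h
  · rw [h, hfab, Function.update_of_ne hab.symm]
  · rw [Function.update_of_ne h]

lemma wordMap_surjective (n : ℕ) : Function.Surjective (wordMap n) := fun f =>
  let ⟨w, hw⟩ := exists_wordMap f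
  ⟨w, funext hw⟩

theorem isPresentation_rel (n : ℕ) : IsPresentation n (Rel n) :=
  ⟨wordMap_surjective n, fun _ _ =>
    ⟨fun h => (Con.conGen_le (c := Con.ker (wordMap n))).2 (fun _ _ h => wordMap_eq_of_rel h) h,
      conGen_of_wordMap_eq⟩⟩

end NormalForm

open FirstOrder.Language

/-! ### Finiteness and positivity of the axioms -/

section Axioms

variable {n : ℕ}

instance : Finite (Gen n) := by
  refine Finite.of_injective
    (β := Bool × Fin n × Fin n)
    (fun g => match g with
      | .repl i j _ => (true, i, j)
      | .transp i j _ => (false, i, j)) ?_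
  rintro (⟨i, j, h⟩ | ⟨i, j, h⟩) (⟨i', j', h'⟩ | ⟨i', j', h'⟩) e <;> simp_all

lemma finite_endoAxioms : (endoAxioms n).Finite := by
  have : endoAxioms n = ⋃ g : Gen n,
      {(tSubst g (tMeet (x 0) (x 1)), tMeet (tSubst g (x 0)) (tSubst g (x 1))),
        (tSubst g (tJoin (x 0) (x 1)), tJoin (tSubst g (x 0)) (tSubst g (x 1))),
        (tSubst g tZero, tZero), (tSubst g tOne, tOne)} := by
    ext e
    simp [endoAxioms]
  rw [this]
  exact Set.finite_iUnion fun g => Set.toFinite _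

/-- This bound gives finiteness: there are finitely many words of length at most 3 over the finite
alphabet `Gen n`. -/
lemma length_le_of_rel {v w : FreeMonoid (Gen n)} (h : Rel n v w) :
    v.toList.length ≤ 3 ∧ w.toList.length ≤ 3 := by
  cases h <;> simp [t, r]

lemma finite_relAxioms : (relAxioms (Rel n)).Finite := by
  have hfin : {l : List (Gen n) | l.length ≤ 3}.Finite := List.finite_length_le _ _
  refine ((hfin.prod hfin).image fun p =>
    ((tWord (FreeMonoid.ofList p.1) (x 0), tWord (FreeMonoid.ofList p.2) (x 0)) : Eqn n)).subset ?_
  rintro _ ⟨v, w, h, rfl⟩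
  exact ⟨(v.toList, w.toList), length_le_of_rel h, rfl⟩

lemma finite_Ax : (Ax n).Finite := by
  refine Set.Finite.union (Set.Finite.union ?_ finite_endoAxioms) finite_relAxioms
  unfold booleanAxioms
  exact Set.toFinite _

lemma positive_tWord (w : FreeMonoid (Gen n)) {a : Tm n} (ha : Positive a) :
    Positive (tWord w a) := by
  unfold tWord
  induction w.toList with
  | nil => exact ha
  | cons g l ih => exact ih.subst g

lemma positive_of_mem {e : Eqn n} (he : e ∈ endoAxioms n ∪ relAxioms (Rel n)) :
    Positive e.1 ∧ Positive e.2 := by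
  have hx := @Positive.var n
  rcases he with ⟨g, rfl | rfl | rfl | rfl⟩ | ⟨v, w, -, rfl⟩
  · exact ⟨((hx 0).meet (hx 1)).subst g, ((hx 0).subst g).meet ((hx 1).subst g)⟩
  · exact ⟨((hx 0).join (hx 1)).subst g, ((hx 0).subst g).join ((hx 1).subst g)⟩
  · exact ⟨Positive.zero.subst g, .zero⟩
  · exact ⟨Positive.one.subst g, .one⟩
  · exact ⟨positive_tWord v (hx 0), positive_tWord w (hx 0)⟩

end Axioms

/-! ### Classes defined by equations are varieties -/

section Varieties

variable {n : ℕ} {E : Set (Eqn n)}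

lemma H_Mod_subset : H (Mod.{u} E) ⊆ Mod E := by
  rintro A ⟨B, hB, f, hf⟩ e he v
  -- Surjectivity lifts every valuation in `A` to one in `B`.
  obtain ⟨v', rfl⟩ : ∃ v', v = f ∘ v' :=
    ⟨fun i => (hf (v i)).choose, funext fun i => ((hf (v i)).choose_spec).symm⟩
  rw [HomClass.realize_term, HomClass.realize_term, hB e he v']

lemma S_Mod_subset : S (Mod.{u} E) ⊆ Mod E := by
  rintro A ⟨B, hB, ⟨f⟩⟩ e he v
  apply f.injective
  rw [← HomClass.realize_term, ← HomClass.realize_term, hB e he]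

/-- The projections of a direct product. -/
def prodAlgProj {I : Type u} (F : I → Alg.{u} n) (i : I) :
    (prodAlg F).carrier →[lang n] (F i).carrier where
  toFun a := a i
  map_fun' _ _ := rfl
  map_rel' r _ := nomatch r

lemma prodAlg_mem_Mod {I : Type u} {F : I → Alg.{u} n} (hF : ∀ i, F i ∈ Mod E) :
    prodAlg F ∈ Mod E := by
  intro e he v
  funext i
  change prodAlgProj F i _ = prodAlgProj F i _
  rw [← HomClass.realize_term, ← HomClass.realize_term, hF i e he]

lemma P_Mod_subset : P (Mod.{u} E) ⊆ Mod E := by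
  rintro A ⟨I, F, hF, ⟨f⟩⟩
  exact S_Mod_subset ⟨_, prodAlg_mem_Mod hF, ⟨f.toEmbedding⟩⟩

theorem isVariety_Mod (E : Set (Eqn n)) : IsVariety (Mod.{u} E) :=
  ⟨H_Mod_subset, S_Mod_subset, P_Mod_subset⟩

lemma S_mono {K L : Set (Alg.{u} n)} (h : K ⊆ L) : S K ⊆ S L :=
  fun _ ⟨B, hB, f⟩ => ⟨B, h hB, f⟩

lemma P_mono {K L : Set (Alg.{u} n)} (h : K ⊆ L) : P K ⊆ P L :=
  fun _ ⟨I, F, hF, f⟩ => ⟨I, F, fun i => h (hF i), f⟩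

lemma subset_S (K : Set (Alg.{u} n)) : K ⊆ S K :=
  fun A hA => ⟨A, hA, ⟨Embedding.refl (lang n) A.carrier⟩⟩

end Varieties

/-! ### The operations of an algebra -/

section Operations

variable {n : ℕ} (A : Alg.{u} n)

/-- Meet in an algebra. -/
def Alg.meet (a b : A.carrier) : A.carrier :=
  Structure.funMap (L := lang n) (Op.meet : Op n 2) ![a, b]

/-- Complement in an algebra. -/
def Alg.compl (a : A.carrier) : A.carrier :=
  Structure.funMap (L := lang n) (Op.compl : Op n 1) ![a]

/-- The substitution operations of an algebra. -/
def Alg.subst (g : Gen n) (a : A.carrier) : A.carrier :=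
  Structure.funMap (L := lang n) (Op.subst g : Op n 1) ![a]

/-- Join in an algebra. -/
def Alg.join (a b : A.carrier) : A.carrier := A.compl (A.meet (A.compl a) (A.compl b))

/-- The action of words on an algebra. -/
def Alg.act : FreeMonoid (Gen n) →* Function.End A.carrier :=
  FreeMonoid.lift fun g => (A.subst g : A.carrier → A.carrier)

lemma Alg.act_one (a : A.carrier) : A.act 1 a = a := by rw [map_one]; rfl

lemma Alg.act_mul (v w : FreeMonoid (Gen n)) (a : A.carrier) :
    A.act (v * w) a = A.act v (A.act w a) := by
  rw [map_mul]; rfl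

lemma Alg.act_of (g : Gen n) (a : A.carrier) : A.act (FreeMonoid.of g) a = A.subst g a :=
  rfl

variable {A}
variable (v : ℕ → A.carrier)

@[simp] lemma realize_x (i : ℕ) : (x i : Tm n).realize v = v i := rfl

@[simp] lemma realize_tMeet (a b : Tm n) :
    (tMeet a b).realize v = A.meet (a.realize v) (b.realize v) :=
  congrArg (Structure.funMap (L := lang n) (Op.meet : Op n 2))
    (funext fun i => by fin_cases i <;> rfl)

@[simp] lemma realize_tCompl (a : Tm n) : (tCompl a).realize v = A.compl (a.realize v) :=
  congrArg (Structure.funMap (L := lang n) (Op.compl : Op n 1))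
    (funext fun i => by fin_cases i; rfl)

@[simp] lemma realize_tSubst (g : Gen n) (a : Tm n) :
    (tSubst g a).realize v = A.subst g (a.realize v) :=
  congrArg (Structure.funMap (L := lang n) (Op.subst g : Op n 1))
    (funext fun i => by fin_cases i; rfl)

@[simp] lemma realize_tJoin (a b : Tm n) :
    (tJoin a b).realize v = A.join (a.realize v) (b.realize v) := by
  simp [tJoin, Alg.join]

@[simp] lemma realize_tWord (w : FreeMonoid (Gen n)) (a : Tm n) :
    (tWord w a).realize v = A.act w (a.realize v) := by
  induction w using FreeMonoid.inductionOn' with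
  | one => exact (A.act_one _).symm
  | of_mul g w ih =>
    rw [A.act_mul, A.act_of, ← ih, ← realize_tSubst]; rfl

end Operations

/-! ### Set algebras are models -/

section SetAlgebras

variable {n : ℕ} {U : Type u}

/-- Membership in an element of the full set algebra. -/
def fullMem (q : Fin n → U) (X : (fullAlg n U).carrier) : Prop := q ∈ (show Set (Fin n → U) from X)

lemma fullAlg_ext {X Y : (fullAlg n U).carrier} (h : ∀ q, fullMem q X ↔ fullMem q Y) : X = Y :=
  Set.ext h

lemma fullMem_meet (q : Fin n → U) (X Y : (fullAlg n U).carrier) :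
    fullMem q ((fullAlg n U).meet X Y) ↔ fullMem q X ∧ fullMem q Y := Iff.rfl

lemma fullMem_compl (q : Fin n → U) (X : (fullAlg n U).carrier) :
    fullMem q ((fullAlg n U).compl X) ↔ ¬ fullMem q X := Iff.rfl

lemma fullMem_subst (q : Fin n → U) (g : Gen n) (X : (fullAlg n U).carrier) :
    fullMem q ((fullAlg n U).subst g X) ↔ fullMem (q ∘ g.toFun) X := Iff.rfl

lemma fullMem_join (q : Fin n → U) (X Y : (fullAlg n U).carrier) :
    fullMem q ((fullAlg n U).join X Y) ↔ fullMem q X ∨ fullMem q Y := by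
  rw [Alg.join, fullMem_compl, fullMem_meet, fullMem_compl, fullMem_compl]
  tauto

lemma fullMem_act (q : Fin n → U) (w : FreeMonoid (Gen n)) (X : (fullAlg n U).carrier) :
    fullMem q ((fullAlg n U).act w X) ↔ fullMem (fun i => q (wordMap n w i)) X := by
  induction w using FreeMonoid.inductionOn' generalizing q with
  | one => exact Iff.rfl
  | of_mul g w ih =>
    have h : (fun i => q (wordMap n (FreeMonoid.of g * w) i)) =
        fun i => (q ∘ g.toFun) (wordMap n w i) := funext fun i => by rw [wordMap_mul]; rfl
    rw [Alg.act_mul, Alg.act_of, fullMem_subst, ih, h]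

lemma fullAlg_mem_SA (n : ℕ) (U : Type u) : fullAlg n U ∈ SA n := by
  rintro e ((he | ⟨g, he⟩) | ⟨v₁, v₂, h, rfl⟩) v <;> refine fullAlg_ext fun q => ?_
  · rcases he with rfl | rfl | rfl | rfl | rfl | rfl | rfl | rfl | rfl | rfl <;>
      simp only [realize_tMeet, realize_tJoin, realize_tCompl, realize_x, tZero, tOne,
        fullMem_meet, fullMem_join, fullMem_compl] <;> tauto
  · rcases he with rfl | rfl | rfl | rfl <;>
      simp only [realize_tMeet, realize_tJoin, realize_tCompl, realize_tSubst, realize_x, tZero,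
        tOne, fullMem_meet, fullMem_join, fullMem_compl, fullMem_subst] <;> tauto
  · simp only [realize_tWord, realize_x, fullMem_act]
    rw [wordMap_eq_of_rel h]

lemma RSA_subset_SA (n : ℕ) : RSA.{u} n ⊆ SA n := by
  have h : SetSA.{u} n ⊆ SA n := by
    refine (S_mono ?_).trans S_Mod_subset
    rintro _ ⟨U, rfl⟩
    exact fullAlg_mem_SA n U
  exact (S_mono ((P_mono h).trans P_Mod_subset)).trans S_Mod_subset

end SetAlgebras

/-! ### Representation of models -/

section Representation

variable {n : ℕ}

/-- Variables `x₀, x₁, x₂` interpreted as `a, b, c`. -/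
def assign {α : Type u} (a b c : α) : ℕ → α
  | 0 => a
  | 1 => b
  | _ => c

lemma eq_of_mem_booleanAxioms {A : Alg.{u} n} (hA : A ∈ SA n) {e : Eqn n}
    (he : e ∈ booleanAxioms n) (a b c : A.carrier) :
    e.1.realize (assign a b c) = e.2.realize (assign a b c) :=
  hA e (Or.inl (Or.inl he)) _

/-- The Boolean algebra underlying a model of the axioms. -/
noncomputable abbrev booleanAlgebraOfMem {A : Alg.{u} n} (hA : A ∈ SA n) :
    BooleanAlgebra A.carrier :=
  have ax := fun {e} he => eq_of_mem_booleanAxioms (e := e) hA he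
  have meet_comm : ∀ a b, A.meet a b = A.meet b a := fun a b => by
    simpa [assign] using
      ax (e := (tMeet (x 0) (x 1), tMeet (x 1) (x 0))) (by simp [booleanAxioms]) a b b
  have join_comm : ∀ a b, A.join a b = A.join b a := fun a b => by
    simpa [assign] using
      ax (e := (tJoin (x 0) (x 1), tJoin (x 1) (x 0))) (by simp [booleanAxioms]) a b b
  have meet_assoc : ∀ a b c, A.meet (A.meet a b) c = A.meet a (A.meet b c) := fun a b c => by
    simpa [assign] using
      ax (e := (tMeet (tMeet (x 0) (x 1)) (x 2), tMeet (x 0) (tMeet (x 1) (x 2))))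
        (by simp [booleanAxioms]) a b c
  have join_assoc : ∀ a b c, A.join (A.join a b) c = A.join a (A.join b c) := fun a b c => by
    simpa [assign] using
      ax (e := (tJoin (tJoin (x 0) (x 1)) (x 2), tJoin (x 0) (tJoin (x 1) (x 2))))
        (by simp [booleanAxioms]) a b c
  have meet_join : ∀ a b, A.meet a (A.join a b) = a := fun a b => by
    simpa [assign] using
      ax (e := (tMeet (x 0) (tJoin (x 0) (x 1)), x 0)) (by simp [booleanAxioms]) a b b
  have join_meet : ∀ a b, A.join a (A.meet a b) = a := fun a b => by
    simpa [assign] using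
      ax (e := (tJoin (x 0) (tMeet (x 0) (x 1)), x 0)) (by simp [booleanAxioms]) a b b
  have distrib : ∀ a b c, A.join a (A.meet b c) = A.meet (A.join a b) (A.join a c) :=
    fun a b c => by
      simpa [assign] using
        ax (e := (tJoin (x 0) (tMeet (x 1) (x 2)), tMeet (tJoin (x 0) (x 1)) (tJoin (x 0) (x 2))))
          (by simp [booleanAxioms]) a b c
  have join_zero : ∀ a b, A.join b (A.meet a (A.compl a)) = b := fun a b => by
    simpa [assign, tZero] using
      ax (e := (tJoin (x 1) tZero, x 1)) (by simp [booleanAxioms]) a b b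
  have meet_one : ∀ a b, A.meet b (A.join a (A.compl a)) = b := fun a b => by
    simpa [assign, tOne] using
      ax (e := (tMeet (x 1) tOne, x 1)) (by simp [booleanAxioms]) a b b
  letI : Max A.carrier := ⟨A.join⟩
  letI : Min A.carrier := ⟨A.meet⟩
  letI : Lattice A.carrier :=
    Lattice.mk' join_comm join_assoc meet_comm meet_assoc join_meet meet_join
  -- The choice is harmless: `join_zero` and `meet_one` make every `a · -a` neutral for join and
  -- every `a + -a` neutral for meet.
  let o : A.carrier := Classical.arbitrary A.carrier
  { (inferInstance : Lattice A.carrier) with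
    le_sup_inf := fun a b c => (distrib a b c).ge
    compl := A.compl
    top := A.join o (A.compl o)
    bot := A.meet o (A.compl o)
    inf_compl_le_bot := fun a => sup_eq_right.1 ((join_comm _ _).trans (join_zero a _))
    top_le_sup_compl := fun a => inf_eq_left.1 (meet_one a _)
    le_top := fun a => inf_eq_left.1 (meet_one o a)
    bot_le := fun a => sup_eq_right.1 ((join_comm _ _).trans (join_zero o a)) }

/-- The characteristic predicates of ultrafilters. -/
structure IsUltra (A : Alg.{u} n) (F : A.carrier → Prop) : Prop where
  meet : ∀ a b, F (A.meet a b) ↔ F a ∧ F b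
  compl : ∀ a, F (A.compl a) ↔ ¬ F a

/-- The prime ideal theorem: if `a ≰ b`, some prime ideal contains `b` but not `a`, and its
complement is an ultrafilter. -/
lemma exists_isUltra {A : Alg.{u} n} (hA : A ∈ SA n) {a b : A.carrier} (hab : a ≠ b) :
    ∃ F, IsUltra A F ∧ ¬ (F a ↔ F b) := by
  let _ := booleanAlgebraOfMem hA
  have key : ∀ a b : A.carrier, ¬ a ≤ b → ∃ F, IsUltra A F ∧ F a ∧ ¬ F b := by
    intro a b h
    obtain ⟨J, hJ, hbJ, hdisj⟩ := DistribLattice.prime_ideal_of_disjoint_filter_ideal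
      (F := Order.PFilter.principal a) (I := Order.Ideal.principal b) <| by
        rw [Set.disjoint_left]
        intro c hac hcb
        exact h (le_trans (Order.PFilter.mem_principal.1 hac) (Order.Ideal.mem_principal.1 hcb))
    refine ⟨fun c => c ∉ J, ⟨fun c d => ?_, fun c => ?_⟩, ?_, ?_⟩
    · have : A.meet c d ∈ J ↔ c ∈ J ∨ d ∈ J :=
        ⟨hJ.mem_or_mem, fun h => h.elim (J.lower inf_le_left) (J.lower inf_le_right)⟩
      tauto
    · refine ⟨fun h h' => h (hJ.compl_mem_of_notMem h'), fun h h' => ?_⟩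
      have htop : c ⊔ cᶜ ∈ J := Order.Ideal.sup_mem (not_not.1 h) h'
      rw [sup_compl_eq_top] at htop
      exact hJ.toIsProper.top_notMem htop
    · exact Set.disjoint_left.1 hdisj (Order.PFilter.mem_principal.2 le_rfl)
    · exact not_not.2 (hbJ (Order.Ideal.mem_principal.2 le_rfl))
  by_cases h : a ≤ b
  · obtain ⟨F, hF, hb, ha⟩ := key b a fun h' => hab (le_antisymm h h')
    exact ⟨F, hF, fun e => ha (e.2 hb)⟩
  · obtain ⟨F, hF, ha, hb⟩ := key a b h
    exact ⟨F, hF, fun e => hb (e.1 ha)⟩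

section Action

variable {A : Alg.{u} n} (hA : A ∈ SA n)
include hA

lemma eq_of_mem_endoAxioms {e : Eqn n} (he : e ∈ endoAxioms n) (a b : A.carrier) :
    e.1.realize (assign a b b) = e.2.realize (assign a b b) :=
  hA e (Or.inl (Or.inr he)) _

lemma subst_meet (g : Gen n) (a b : A.carrier) :
    A.subst g (A.meet a b) = A.meet (A.subst g a) (A.subst g b) := by
  simpa [assign] using eq_of_mem_endoAxioms hA ⟨g, Or.inl rfl⟩ a b

/-- The axioms do not mention complements here, but preservation of meet, join, `0` and `1` makes
the image of `-a` a complement of the image of `a`, and complements are unique. -/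
lemma subst_compl (g : Gen n) (a : A.carrier) :
    A.subst g (A.compl a) = A.compl (A.subst g a) := by
  have hjoin : A.subst g (A.join a (A.compl a)) = A.join (A.subst g a) (A.subst g (A.compl a)) := by
    simpa [assign] using eq_of_mem_endoAxioms hA ⟨g, Or.inr (Or.inl rfl)⟩ a (A.compl a)
  have hzero : A.subst g (A.meet a (A.compl a)) = A.meet a (A.compl a) := by
    simpa [assign, tZero] using eq_of_mem_endoAxioms hA ⟨g, Or.inr (Or.inr (Or.inl rfl))⟩ a a
  have hone : A.subst g (A.join a (A.compl a)) = A.join a (A.compl a) := by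
    simpa [assign, tOne] using eq_of_mem_endoAxioms hA ⟨g, Or.inr (Or.inr (Or.inr rfl))⟩ a a
  rw [subst_meet hA] at hzero
  rw [hjoin] at hone
  let _ := booleanAlgebraOfMem hA
  have h : IsCompl (A.subst g a) (A.subst g (A.compl a)) := IsCompl.of_eq
    (hzero.trans (inf_compl_eq_bot (a := a))) (hone.trans (sup_compl_eq_top (x := a)))
  exact h.compl_eq.symm

lemma act_meet (w : FreeMonoid (Gen n)) (a b : A.carrier) :
    A.act w (A.meet a b) = A.meet (A.act w a) (A.act w b) := by
  induction w using FreeMonoid.inductionOn' with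
  | one => simp only [Alg.act_one]
  | of_mul g w ih => simp only [Alg.act_mul, Alg.act_of, ih, subst_meet hA]

lemma act_compl (w : FreeMonoid (Gen n)) (a : A.carrier) :
    A.act w (A.compl a) = A.compl (A.act w a) := by
  induction w using FreeMonoid.inductionOn' with
  | one => simp only [Alg.act_one]
  | of_mul g w ih => simp only [Alg.act_mul, Alg.act_of, ih, subst_compl hA]

/-- The action of a word only depends on its value. -/
lemma act_eq_of_wordMap_eq {v w : FreeMonoid (Gen n)} (h : wordMap n v = wordMap n w) :
    A.act v = A.act w := by
  refine (Con.conGen_le (c := Con.ker A.act)).2 (fun v w h => ?_) (conGen_of_wordMap_eq h)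
  funext a
  simpa using hA (tWord v (x 0), tWord w (x 0)) (Or.inr ⟨v, w, h, rfl⟩) fun _ => a

end Action

/-- A word with a given value. -/
noncomputable def word (f : Fin n → Fin n) : FreeMonoid (Gen n) := (exists_wordMap f).choose

lemma wordMap_word (f : Fin n → Fin n) (i : Fin n) : wordMap n (word f) i = f i :=
  (exists_wordMap f).choose_spec i

/-- The base of the set algebras that represent a model. -/
abbrev Base (n : ℕ) : Type u := ULift.{u} (Fin n)

/-- The representation of `a` determined by `F`: the set of all `q` such that `s_q a` is in `F`. -/
def rep (A : Alg.{u} n) (F : A.carrier → Prop) (a : A.carrier) :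
    (fullAlg n (Base.{u} n)).carrier :=
  ({q | F (A.act (word fun i => (q i).down) a)} : Set (Fin n → Base.{u} n))

lemma fullMem_rep {A : Alg.{u} n} {F : A.carrier → Prop} (q : Fin n → Base.{u} n)
    (a : A.carrier) : fullMem q (rep A F a) ↔ F (A.act (word fun i => (q i).down) a) := Iff.rfl

lemma rep_map_fun {A : Alg.{u} n} (hA : A ∈ SA n) {F : A.carrier → Prop} (hF : IsUltra A F)
    {k : ℕ} (f : (lang n).Functions k) (a : Fin k → A.carrier) :
    rep A F (Structure.funMap f a) = Structure.funMap f (rep A F ∘ a) := by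
  have one_eq : ∀ {B : Type u} (b : Fin 1 → B), b = ![b 0] := fun b =>
    funext fun i => by fin_cases i; rfl
  have two_eq : ∀ {B : Type u} (b : Fin 2 → B), b = ![b 0, b 1] := fun b =>
    funext fun i => by fin_cases i <;> rfl
  refine fullAlg_ext fun q => ?_
  cases f with
  | meet =>
    rw [two_eq a, two_eq (_ ∘ _)]
    refine Iff.trans ?_ (fullMem_meet q (rep A F (a 0)) (rep A F (a 1))).symm
    simp only [fullMem_rep]
    rw [← hF.meet, ← act_meet hA]
    exact Iff.rfl
  | compl =>
    rw [one_eq a, one_eq (_ ∘ _)]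
    refine Iff.trans ?_ (fullMem_compl q (rep A F (a 0))).symm
    simp only [fullMem_rep]
    rw [← hF.compl, ← act_compl hA]
    exact Iff.rfl
  | subst g =>
    rw [one_eq a, one_eq (_ ∘ _)]
    refine Iff.trans ?_ (fullMem_subst q g (rep A F (a 0))).symm
    simp only [fullMem_rep]
    -- The presentation enters here: both words have value `q ∘ g`, so they act alike.
    have h : A.act (word (fun i => (q i).down) * FreeMonoid.of g) =
        A.act (word fun i => ((q ∘ g.toFun) i).down) :=
      act_eq_of_wordMap_eq hA <| funext fun i => by
        rw [wordMap_mul, wordMap_word, wordMap_word]; rfl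
    rw [← h, Alg.act_mul, Alg.act_of]
    exact Iff.rfl

lemma SA_subset_RSA (n : ℕ) : SA.{u} n ⊆ RSA n := by
  intro A hA
  -- One factor per ultrafilter; for a one-element model there are none, and the empty product
  -- serves.
  let F : {F : A.carrier → Prop // IsUltra A F} → Alg.{u} n := fun _ => fullAlg n (Base.{u} n)
  refine ⟨prodAlg F, ⟨_, F, fun _ => subset_S _ ⟨_, rfl⟩, ⟨FirstOrder.Language.Equiv.refl (lang n) _⟩⟩, ⟨?_⟩⟩
  refine
    { toFun := fun a f => rep A f.1 a
      inj' := fun a b hab => ?_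
      map_fun' := fun f a => funext fun G => rep_map_fun hA G.2 f a
      map_rel' := fun r _ => nomatch r }
  by_contra hne
  obtain ⟨G, hG, hGab⟩ := exists_isUltra hA hne
  have hrep : rep A G a = rep A G b := congrFun hab ⟨G, hG⟩
  -- At the identity sequence, membership in `rep A G a` is just `G a`.
  have hid : A.act (word fun i => i) = A.act 1 :=
    act_eq_of_wordMap_eq hA <| funext fun i => wordMap_word _ i
  have h := iff_of_eq (congrArg (fullMem ULift.up) hrep)
  rw [fullMem_rep, fullMem_rep, hid, Alg.act_one, Alg.act_one] at h
  exact hGab h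

theorem RSA_eq_SA (n : ℕ) : RSA.{u} n = SA n :=
  (RSA_subset_SA n).antisymm (SA_subset_RSA n)

end Representation

end SubstAlg

theorem mainTheorem1 (n : ℕ) (hn : 2 ≤ n) :
    (SubstAlg.Ax n).Finite ∧
    (∀ e ∈ SubstAlg.endoAxioms n ∪ SubstAlg.relAxioms (SubstAlg.Rel n),
      SubstAlg.Positive e.1 ∧ SubstAlg.Positive e.2) ∧
    SubstAlg.IsPresentation n (SubstAlg.Rel n) ∧
    SubstAlg.RSA.{u} n = SubstAlg.SA.{u} n ∧
    SubstAlg.IsVariety (SubstAlg.RSA.{u} n) ∧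
    SubstAlg.IsFinitelyBased (SubstAlg.RSA.{u} n) := by
  refine ⟨SubstAlg.finite_Ax, fun e he => SubstAlg.positive_of_mem he,
    SubstAlg.isPresentation_rel n, SubstAlg.RSA_eq_SA n, ?_, ?_⟩
  · rw [SubstAlg.RSA_eq_SA]
    exact SubstAlg.isVariety_Mod _
  · exact ⟨SubstAlg.Ax n, SubstAlg.finite_Ax, SubstAlg.RSA_eq_SA n⟩
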